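/- All rings are commutative with unity. Let $R$ be a commutative ring. An ideal $J$ of $R$ is a GV-ideal if it is finitely generated and the natural map $R\to\operatorname{Hom}_R(J,R)$, $r\mapsto(x\mapsto rx)$, is an isomorphism. An $R$-module $N$ is GV-torsion-free if no nonzero $x\in N$ satisfies $Jx=0$ for a GV-ideal $J$; such an $N$ is a $w$-module if moreover $\operatorname{Ext}^1_R(R/J,N)=0$ for every GV-ideal $J$. A maximal $w$-ideal is an ideal that is maximal among the proper ideals of $R$ that are $w$-modules (such an ideal is always prime). A sequence $0\to A\to B\to C\to 0$ of $R$-modules is $w$-exact if its localization at every maximal $w$-ideal is exact, and it is $w$-pure exact if it is $w$-exact and remains $w$-exact after tensoring with any $R$-module. A submodule $A$ of $B$ is $w$-pure if $0\to A\to B\to B/A\to 0$ is $w$-pure exact. An $R$-module $A$ is absolutely $w$-pure if it is a $w$-pure submodule of every $R$-module that contains it as a submodule. An $R$-module $M$ is $w$-FP-projective if $\operatorname{Ext}^1_R(M,A)=0$ for every absolutely $w$-pure $R$-module $A$. If $R$ is a domain with fraction field $K$, the $w$-envelope of a fractional ideal $I$ is $I_w=\{x\in K : Jx\subseteq I \text{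 for some GV-ideal } J\}$, and $I$ is $w$-invertible if $(II^{-1})_w=R$, where $I^{-1}=\{x\in K : xI\subseteq R\}$. A domain $R$ is a Prüfer $v$-multiplication domain if every nonzero finitely generated ideal of $R$ is $w$-invertible. **Proposition.** Let $R$ be a Prüfer $v$-multiplication domain. Then $\operatorname{pd}_R(M)\leq 1$ for every $w$-FP-projective $R$-module $M$. -/

import Mathlib

open scoped TensorProduct nonZeroDivisors

universe u

section WOperation

variable {R : Type u} [CommRing R]

/-- A Glaz–Vasconcelos ideal: `J` is finitely generated and the natural homomorphism
`R → Hom_R(J, R)`, `r ↦ (x ↦ r * x)`, is an isomorphism. -/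
def IsGVIdeal (J : Ideal R) : Prop :=
  J.FG ∧ Function.Bijective (LinearMap.toSpanSingleton R (J →ₗ[R] R) J.subtype)

variable (R) in
/-- `M` is GV-torsion-free: the only element killed by some GV-ideal is `0`. -/
def IsGVTorsionFree (M : Type u) [AddCommGroup M] [Module R M] : Prop :=
  ∀ x : M, (∃ J : Ideal R, IsGVIdeal J ∧ ∀ a ∈ J, a • x = 0) → x = 0

variable (R) in
/-- `M` is a `w`-module: it is GV-torsion-free and `Ext¹_R(R/J, M) = 0` for every GV-ideal `J`. -/
def IsWModule (M : Type u) [AddCommGroup M] [Module R M] : Prop :=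
  IsGVTorsionFree R M ∧
    ∀ J : Ideal R, IsGVIdeal J →
      Subsingleton (CategoryTheory.Abelian.Ext (ModuleCat.of R (R ⧸ J)) (ModuleCat.of R M) 1)

/-- A maximal `w`-ideal: an ideal that is maximal among the proper ideals which are `w`-modules. -/
def IsMaximalWIdeal (p : Ideal R) : Prop :=
  Maximal (fun I : Ideal R => I ≠ ⊤ ∧ IsWModule R I) p

/-- The sequence `0 → A → B → C → 0` given by `f` and `g` is `w`-exact: its localization at every
maximal `w`-ideal `p` of `R` is exact. (Every maximal `w`-ideal is prime, so asking for the
instance `p.IsPrime`, which the localization needs, leaves out no maximal `w`-ideal.) -/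
def IsWExact {A B C : Type u} [AddCommGroup A] [Module R A] [AddCommGroup B] [Module R B]
    [AddCommGroup C] [Module R C] (f : A →ₗ[R] B) (g : B →ₗ[R] C) : Prop :=
  ∀ (p : Ideal R) [p.IsPrime], IsMaximalWIdeal p →
    Function.Injective (LocalizedModule.map p.primeCompl f) ∧
    Function.Exact (LocalizedModule.map p.primeCompl f) (LocalizedModule.map p.primeCompl g) ∧
    Function.Surjective (LocalizedModule.map p.primeCompl g)

/-- The sequence `0 → A → B → C → 0` is `w`-pure exact: it is `w`-exact, and it stays `w`-exact
after tensoring with any `R`-module. -/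
def IsWPureExact {A B C : Type u} [AddCommGroup A] [Module R A] [AddCommGroup B] [Module R B]
    [AddCommGroup C] [Module R C] (f : A →ₗ[R] B) (g : B →ₗ[R] C) : Prop :=
  IsWExact f g ∧
    ∀ (M : Type u) [AddCommGroup M] [Module R M], IsWExact (f.rTensor M) (g.rTensor M)

/-- `A` is a `w`-pure submodule of `B`: the sequence `0 → A → B → B/A → 0` is `w`-pure exact. -/
def IsWPureSubmodule {B : Type u} [AddCommGroup B] [Module R B] (A : Submodule R B) : Prop :=
  IsWPureExact A.subtype A.mkQ

variable (R) in
/-- `A` is absolutely `w`-pure: it is a `w`-pure submodule of every `R`-module containing it. -/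
def IsAbsolutelyWPure (A : Type u) [AddCommGroup A] [Module R A] : Prop :=
  ∀ (B : Type u) [AddCommGroup B] [Module R B] (f : A →ₗ[R] B), Function.Injective f →
    IsWPureSubmodule (LinearMap.range f)

variable (R) in
/-- `M` is `w`-FP-projective: `Ext¹_R(M, A) = 0` for every absolutely `w`-pure module `A`. -/
def IsWFPProjective (M : Type u) [AddCommGroup M] [Module R M] : Prop :=
  ∀ (A : Type u) [AddCommGroup A] [Module R A], IsAbsolutelyWPure R A →
    Subsingleton (CategoryTheory.Abelian.Ext (ModuleCat.of R M) (ModuleCat.of R A) 1)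

end WOperation

section PvMD

variable {R : Type u} [CommRing R] [IsDomain R]

/-- The `w`-envelope `I_w = {x ∈ K | J x ⊆ I for some GV-ideal J}` of a fractional ideal `I` of the
domain `R`; the fraction field `K` is the injective hull of `I` when `I ≠ 0`. -/
def wEnvelope (I : FractionalIdeal R⁰ (FractionRing R)) : Set (FractionRing R) :=
  {x | ∃ J : Ideal R, IsGVIdeal J ∧ ∀ a ∈ J, a • x ∈ I}

/-- A fractional ideal `I` is `w`-invertible if `(I I⁻¹)_w = R`. -/
def IsWInvertible (I : FractionalIdeal R⁰ (FractionRing R)) : Prop :=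
  wEnvelope (I * I⁻¹) = Set.range (algebraMap R (FractionRing R))

variable (R) in
/-- The domain `R` is a Prüfer `v`-multiplication domain: every nonzero finitely generated ideal
is `w`-invertible. -/
def IsPvMD : Prop :=
  ∀ I : Ideal R, I ≠ ⊥ → I.FG → IsWInvertible (I : FractionalIdeal R⁰ (FractionRing R))

end PvMD

/-! A maximal `w`-ideal contains no GV-ideal, so over a PvMD every finitely generated ideal becomes
principal in the localization at a maximal `w`-ideal. This localization is thus a Bézout domain, and
torsion-free modules become flat there. A divisible module `D` is then absolutely `w`-pure: torsion
modules tensor to zero with `D`, hence `D ⊗ M` embeds into `D ⊗ M/T` for the torsion submodule `T`,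
and `M/T` is locally flat. Now let `0 → Y → E → Q → 0` be exact with `E` injective. Then `Q` is
divisible, so `Ext¹(M, Q) = 0` for `M` `w`-FP-projective, and `Ext²(M, Y) = 0` by dimension
shifting. -/

section Ext

open CategoryTheory Abelian

universe v v' w

variable {C : Type v} [Category.{v'} C] [Abelian C] [HasExt.{w} C]

theorem exists_comp_eq_of_subsingleton_ext {S : ShortComplex C} (hS : S.ShortExact) {Y : C}
    (hY : Subsingleton (Ext S.X₃ Y 1)) (φ : S.X₁ ⟶ Y) : ∃ ψ : S.X₂ ⟶ Y, S.f ≫ ψ = φ := by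
  obtain ⟨e, he⟩ := Ext.contravariant_sequence_exact₁ hS Y (Ext.mk₀ φ) (n₁ := 1) rfl
    (hY.elim _ _)
  obtain ⟨ψ, rfl⟩ := (Ext.mk₀_bijective _ _).2 e
  rw [Ext.mk₀_comp_mk₀] at he
  exact ⟨ψ, (Ext.mk₀_bijective _ _).1 he⟩

theorem hasProjectiveDimensionLE_one_of_injective_quotients [EnoughInjectives C] (X : C)
    (hX : ∀ {E Q : C} (g : E ⟶ Q) [Injective E] [Epi g], Subsingleton (Ext X Q 1)) :
    HasProjectiveDimensionLE X 1 := by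
  refine hasProjectiveDimensionLT_of_enoughInjectives X 2 fun Y => subsingleton_of_forall_eq 0 ?_
  intro x
  have hS : (ShortComplex.mk (Injective.ι Y) (Limits.cokernel.π _)
      (Limits.cokernel.condition _)).ShortExact :=
    { exact := ShortComplex.exact_cokernel _ }
  obtain ⟨y, rfl⟩ := Ext.covariant_sequence_exact₁ X hS x (Ext.eq_zero_of_injective _)
    (n₀ := 1) rfl
  rw [(hX (Limits.cokernel.π (Injective.ι Y))).elim y 0, Ext.zero_comp]

theorem exists_forall_apply_eq_smul_of_subsingleton_ext {R N : Type u} [CommRing R]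
    [AddCommGroup N] [Module R N] {J : Ideal R}
    (hN : Subsingleton (Ext (ModuleCat.of R (R ⧸ J)) (ModuleCat.of R N) 1)) (φ : J →ₗ[R] N) :
    ∃ x : N, ∀ a : J, φ a = (a : R) • x := by
  have hS : (ModuleCat.shortComplexOfCompEqZero J.subtype J.mkQ
      (LinearMap.exact_subtype_mkQ J).linearMap_comp_eq_zero).ShortExact :=
    ModuleCat.shortComplex_shortExact _ (LinearMap.exact_subtype_mkQ J) J.injective_subtype
      J.mkQ_surjective
  obtain ⟨ψ, hψ⟩ := exists_comp_eq_of_subsingleton_ext hS hN (ModuleCat.ofHom φ)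
  refine ⟨ψ.hom (1 : R), fun a => ?_⟩
  calc φ a = ψ.hom (a : R) := (congrArg (fun χ => χ.hom a) hψ).symm
    _ = ψ.hom ((a : R) • (1 : R)) := by rw [smul_eq_mul, mul_one]
    _ = (a : R) • ψ.hom (1 : R) := map_smul _ _ _

end Ext

section GVIdeal

variable {R : Type u} [CommRing R]

theorem IsGVIdeal.eq_top_of_le {J I : Ideal R} (hJ : IsGVIdeal J) (hI : IsWModule R I)
    (hJI : J ≤ I) : I = ⊤ := by
  obtain ⟨x, hx⟩ := exists_forall_apply_eq_smul_of_subsingleton_ext (hI.2 J hJ)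
    (Submodule.inclusion hJI)
  have one_eq : (1 : R) = x := by
    apply hJ.2.1
    ext a
    simpa [mul_comm] using congrArg Subtype.val (hx a)
  exact (Ideal.eq_top_iff_one I).2 (one_eq ▸ x.2)

theorem IsGVIdeal.not_le_of_isMaximalWIdeal {J p : Ideal R} (hJ : IsGVIdeal J)
    (hp : IsMaximalWIdeal p) : ¬J ≤ p :=
  fun hle => hp.prop.1 (hJ.eq_top_of_le hp.prop.2 hle)

end GVIdeal

section BezoutLocalization

theorem map_algebraMap_isPrincipal_of_dvd_mul {R : Type*} [CommRing R] {S : Submonoid R}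
    (A : Type*) [CommRing A] [Algebra R A] [IsLocalization S A] {I : Ideal R} {x c : R}
    (hx : x ∈ I) (hc : c ∈ S) (hdvd : ∀ z ∈ I, x ∣ c * z) :
    (I.map (algebraMap R A)).IsPrincipal := by
  refine ⟨algebraMap R A x, le_antisymm (Ideal.map_le_iff_le_comap.2 fun z hz => ?_) ?_⟩
  · have hdvd_z : algebraMap R A x ∣ algebraMap R A c * algebraMap R A z := by
      simpa only [map_mul] using map_dvd (algebraMap R A) (hdvd z hz)
    exact Ideal.mem_span_singleton.2
      (((IsLocalization.map_units A ⟨c, hc⟩).dvd_mul_left).1 hdvd_z)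
  · exact (Ideal.span_singleton_le_iff_mem _).2 (Ideal.mem_map_of_mem _ hx)

theorem isBezout_of_forall_map_isPrincipal {R : Type*} [CommRing R] (S : Submonoid R)
    {A : Type*} [CommRing A] [Algebra R A] [IsLocalization S A]
    (h : ∀ I : Ideal R, I.FG → (I.map (algebraMap R A)).IsPrincipal) : IsBezout A := by
  refine IsBezout.iff_span_pair_isPrincipal.2 fun x y => ?_
  have exists_span_eq (x : A) : ∃ a : R, Ideal.span {x} = Ideal.span {algebraMap R A a} := by
    obtain ⟨a, s, rfl⟩ := IsLocalization.exists_mk'_eq S x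
    refine ⟨a, ?_⟩
    rw [← IsLocalization.mk'_spec A a s]
    exact (Ideal.span_singleton_mul_right_unit (IsLocalization.map_units A s) _).symm
  obtain ⟨a, ha⟩ := exists_span_eq x
  obtain ⟨b, hb⟩ := exists_span_eq y
  have hspan : Ideal.span {x, y} = (Ideal.span {a, b}).map (algebraMap R A) := by
    rw [Ideal.map_span, Set.image_pair, Ideal.span_insert, Ideal.span_insert, ha, hb]
  exact hspan ▸ h _ (Submodule.fg_span (Set.toFinite _))

variable {R : Type u} [CommRing R] [IsDomain R] {p : Ideal R}

theorem IsWInvertible.not_mul_inv_le {I : FractionalIdeal R⁰ (FractionRing R)}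
    (hI : IsWInvertible I) (hp : IsMaximalWIdeal p) :
    ¬I * I⁻¹ ≤ (p : FractionalIdeal R⁰ (FractionRing R)) := by
  intro hle
  obtain ⟨J, hJ, hJI⟩ : (1 : FractionRing R) ∈ wEnvelope (I * I⁻¹) := hI ▸ ⟨1, map_one _⟩
  refine hJ.not_le_of_isMaximalWIdeal hp fun a ha => ?_
  obtain ⟨a', ha', haa'⟩ := (FractionalIdeal.mem_coeIdeal _).1 (hle (hJI a ha))
  rw [← Algebra.algebraMap_eq_smul_one] at haa'
  exact IsFractionRing.injective R (FractionRing R) haa' ▸ ha'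

theorem IsWInvertible.exists_dvd_mul {I : Ideal R}
    (hI : IsWInvertible (I : FractionalIdeal R⁰ (FractionRing R))) (hp : IsMaximalWIdeal p) :
    ∃ x ∈ I, ∃ c ∉ p, ∀ z ∈ I, x ∣ c * z := by
  have hinj := IsFractionRing.injective R (FractionRing R)
  have hnot := hI.not_mul_inv_le hp
  simp only [FractionalIdeal.mul_le, not_forall, FractionalIdeal.mem_coeIdeal] at hnot
  obtain ⟨_, ⟨x, hx, rfl⟩, y, hy, hxy⟩ := hnot
  have hI0 : (I : FractionalIdeal R⁰ (FractionRing R)) ≠ 0 := by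
    rw [FractionalIdeal.coeIdeal_ne_zero]
    rintro rfl
    refine hxy ⟨0, p.zero_mem, ?_⟩
    rw [(Submodule.mem_bot R).1 hx, map_zero, zero_mul]
  have exists_eq_mul_y (z : R) (hz : z ∈ I) :
      ∃ r : R, algebraMap R (FractionRing R) r = y * algebraMap R (FractionRing R) z :=
    (FractionalIdeal.mem_one_iff _).1
      ((FractionalIdeal.mem_inv_iff hI0).1 hy _ (FractionalIdeal.mem_coeIdeal_of_mem _ hz))
  obtain ⟨c, hc⟩ := exists_eq_mul_y x hx
  refine ⟨x, hx, c, fun hcp => hxy ⟨c, hcp, by rw [hc, mul_comm]⟩, fun z hz => ?_⟩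
  obtain ⟨r, hr⟩ := exists_eq_mul_y z hz
  refine ⟨r, hinj ?_⟩
  rw [map_mul, map_mul, hc, hr]
  ring

theorem IsPvMD.isBezout_localization (hR : IsPvMD R) [p.IsPrime] (hp : IsMaximalWIdeal p) :
    IsBezout (Localization p.primeCompl) := by
  refine isBezout_of_forall_map_isPrincipal p.primeCompl fun I hI => ?_
  by_cases hI0 : I = ⊥
  · rw [hI0, Ideal.map_bot]
    infer_instance
  · obtain ⟨x, hx, c, hc, hdvd⟩ := (hR I hI0 hI).exists_dvd_mul hp
    exact map_algebraMap_isPrincipal_of_dvd_mul (S := p.primeCompl) _ hx hc hdvd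

end BezoutLocalization

section Flat

theorem localizedModuleMap_comp {R : Type*} [CommSemiring R] (S : Submonoid R) {A B C : Type*}
    [AddCommMonoid A] [Module R A] [AddCommMonoid B] [Module R B] [AddCommMonoid C] [Module R C]
    (f : A →ₗ[R] B) (g : B →ₗ[R] C) :
    LocalizedModule.map S (g ∘ₗ f) = LocalizedModule.map S g ∘ₗ LocalizedModule.map S f := by
  ext x
  induction x using LocalizedModule.induction_on
  simp only [LinearMap.comp_apply, LocalizedModule.map_mk]

theorem isLocalizedModule_lTensor {R : Type*} [CommSemiring R] (S : Submonoid R)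
    {F F' : Type*} [AddCommMonoid F] [Module R F] [AddCommMonoid F'] [Module R F']
    (g : F →ₗ[R] F') [IsLocalizedModule S g] (A : Type*) [AddCommMonoid A] [Module R A] :
    IsLocalizedModule S (g.lTensor A) := by
  have : IsLocalizedModule S (g.rTensor A) := IsLocalizedModule.rTensor (g := g) ..
  rw [← LinearMap.comm_comp_rTensor_comp_comm_eq]
  infer_instance

theorem localizedModuleMap_rTensor_injective_of_flat {R : Type*} [CommRing R] (S : Submonoid R)
    {A B : Type*} [AddCommGroup A] [Module R A] [AddCommGroup B] [Module R B]
    (F : Type*) [AddCommGroup F] [Module R F] [Module.Flat R (LocalizedModule S F)]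
    {f : A →ₗ[R] B} (hf : Function.Injective f) :
    Function.Injective (LocalizedModule.map S (f.rTensor F)) := by
  let ι := LocalizedModule.mkLinearMap S F
  have := isLocalizedModule_lTensor S ι A
  have := isLocalizedModule_lTensor S ι B
  have map_eq : IsLocalizedModule.map S (ι.lTensor A) (ι.lTensor B) (f.rTensor F) =
      f.rTensor (LocalizedModule S F) := by
    apply IsLocalizedModule.linearMap_ext S (ι.lTensor A) (ι.lTensor B)
    rw [IsLocalizedModule.map_comp, LinearMap.rTensor_comp_lTensor, LinearMap.lTensor_comp_rTensor]
  rw [← IsLocalizedModule.map_injective_iff_localizedModuleMap_injective (ι.lTensor A)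
    (ι.lTensor B), map_eq]
  exact Module.Flat.rTensor_preserves_injective_linearMap f hf

theorem flat_localizedModule_of_isBezout {R : Type*} [CommRing R] [IsDomain R] (S : Submonoid R)
    [IsDomain (Localization S)] [IsBezout (Localization S)]
    (F : Type*) [AddCommGroup F] [Module R F] [Module.IsTorsionFree R F] :
    Module.Flat R (LocalizedModule S F) := by
  rw [← Module.flat_iff_of_isLocalization (Localization S) S,
    Module.Flat.flat_iff_torsion_eq_bot_of_isBezout, ← Submodule.isTorsionFree_iff_torsion_eq_bot]
  infer_instance

end Flat

section Divisible

/-- A divisible module, on which every non-zero-divisor of the ring acts surjectively. Unlike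
`DivisibleBy`, this is a proposition and does not ask for a choice of quotients. -/
def IsDivisibleModule (R D : Type*) [CommRing R] [AddCommGroup D] [Module R D] : Prop :=
  ∀ r ∈ R⁰, Function.Surjective fun d : D => r • d

variable {R : Type*} [CommRing R] {D : Type*} [AddCommGroup D] [Module R D]

theorem isDivisibleModule_of_injective {R E : Type u} [CommRing R] [AddCommGroup E] [Module R E]
    [Module.Injective R E] : IsDivisibleModule R E := by
  intro r hr e
  obtain ⟨h, hh⟩ := Module.Injective.out (LinearMap.mulLeft R r)
    (fun _ _ => (mul_cancel_left_mem_nonZeroDivisors hr).1) (LinearMap.toSpanSingleton R E e)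
  refine ⟨h 1, ?_⟩
  simpa [← map_smul] using hh 1

theorem IsDivisibleModule.of_surjective (hD : IsDivisibleModule R D) {Q : Type*} [AddCommGroup Q]
    [Module R Q] {g : D →ₗ[R] Q} (hg : Function.Surjective g) : IsDivisibleModule R Q := by
  intro r hr q
  obtain ⟨d, rfl⟩ := hg q
  obtain ⟨d', rfl⟩ := hD r hr d
  exact ⟨g d', (map_smul g r d').symm⟩

theorem IsDivisibleModule.subsingleton_tensorProduct (hD : IsDivisibleModule R D) {T : Type*}
    [AddCommGroup T] [Module R T] (hT : Module.IsTorsion R T) : Subsingleton (D ⊗[R] T) := by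
  refine subsingleton_of_forall_eq 0 fun x => ?_
  induction x with
  | zero => rfl
  | add x y hx hy => rw [hx, hy, add_zero]
  | tmul d t =>
    obtain ⟨r, hrt⟩ := @hT t
    obtain ⟨d', rfl⟩ := hD r r.2 d
    calc ((r : R) • d') ⊗ₜ[R] t = d' ⊗ₜ[R] ((r : R) • t) := TensorProduct.smul_tmul _ _ _
      _ = 0 := by rw [← Submonoid.smul_def, hrt, TensorProduct.tmul_zero]

theorem IsDivisibleModule.lTensor_mkQ_injective (hD : IsDivisibleModule R D) {M : Type*}
    [AddCommGroup M] [Module R M] {T : Submodule R M} (hT : Module.IsTorsion R T) :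
    Function.Injective (T.mkQ.lTensor D) := by
  have := hD.subsingleton_tensorProduct hT
  rw [← LinearMap.ker_eq_bot, LinearMap.exact_iff.1
    (lTensor_exact D (LinearMap.exact_subtype_mkQ T) T.mkQ_surjective), LinearMap.range_eq_bot]
  exact Subsingleton.elim _ _

theorem IsDivisibleModule.localizedModuleMap_rTensor_injective [IsDomain R]
    (hD : IsDivisibleModule R D) (S : Submonoid R)
    [IsDomain (Localization S)] [IsBezout (Localization S)] {B : Type*} [AddCommGroup B]
    [Module R B] {f : D →ₗ[R] B} (hf : Function.Injective f) (M : Type*)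
    [AddCommGroup M] [Module R M] :
    Function.Injective (LocalizedModule.map S (f.rTensor M)) := by
  let T := Submodule.torsion R M
  have := flat_localizedModule_of_isBezout S (M ⧸ T)
  have hquot := LocalizedModule.map_injective S _
    (hD.lTensor_mkQ_injective (T := T) Submodule.torsion_isTorsion)
  have hflat := localizedModuleMap_rTensor_injective_of_flat S (M ⧸ T) hf
  have hcomm : f.rTensor (M ⧸ T) ∘ₗ T.mkQ.lTensor D = T.mkQ.lTensor B ∘ₗ f.rTensor M := by
    rw [LinearMap.rTensor_comp_lTensor, LinearMap.lTensor_comp_rTensor]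
  have hcomp := hflat.comp hquot
  rw [← LinearMap.coe_comp, ← localizedModuleMap_comp, hcomm, localizedModuleMap_comp,
    LinearMap.coe_comp] at hcomp
  exact hcomp.of_comp

end Divisible

theorem isWPureSubmodule_iff {R B : Type u} [CommRing R] [AddCommGroup B] [Module R B]
    {A : Submodule R B} :
    IsWPureSubmodule A ↔ ∀ (M : Type u) [AddCommGroup M] [Module R M] (p : Ideal R) [p.IsPrime],
      IsMaximalWIdeal p →
        Function.Injective (LocalizedModule.map p.primeCompl (A.subtype.rTensor M)) := by
  have hexact := LinearMap.exact_subtype_mkQ A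
  refine ⟨fun h M _ _ p _ hp => (h.2 M p hp).1, fun h => ⟨fun p _ _ => ⟨?_, ?_, ?_⟩,
    fun M _ _ p _ hp => ⟨h M p hp, ?_, ?_⟩⟩⟩
  · exact LocalizedModule.map_injective _ _ A.injective_subtype
  · exact LocalizedModule.map_exact _ _ _ hexact
  · exact LocalizedModule.map_surjective _ _ A.mkQ_surjective
  · exact LocalizedModule.map_exact _ _ _ (rTensor_exact M hexact A.mkQ_surjective)
  · exact LocalizedModule.map_surjective _ _ (LinearMap.rTensor_surjective M A.mkQ_surjective)

theorem IsPvMD.isAbsolutelyWPure_of_isDivisibleModule {R D : Type u} [CommRing R] [IsDomain R]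
    (hR : IsPvMD R) [AddCommGroup D] [Module R D] (hD : IsDivisibleModule R D) :
    IsAbsolutelyWPure R D := by
  intro B _ _ f _
  refine isWPureSubmodule_iff.2 fun M _ _ p _ hp => ?_
  have := hR.isBezout_localization hp
  exact (hD.of_surjective f.surjective_rangeRestrict).localizedModuleMap_rTensor_injective _
    (LinearMap.range f).injective_subtype M

theorem mainTheorem8 (R : Type u) [CommRing R] [IsDomain R] (hR : IsPvMD R)
    (M : Type u) [AddCommGroup M] [Module R M] (hM : IsWFPProjective R M) :
    CategoryTheory.HasProjectiveDimensionLE (ModuleCat.of R M) 1 := by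
  refine hasProjectiveDimensionLE_one_of_injective_quotients _ fun {E Q} g hE hg => ?_
  have : Module.Injective R E := (Module.injective_iff_injective_object R E).2 hE
  have hQ : IsDivisibleModule R Q :=
    isDivisibleModule_of_injective.of_surjective ((ModuleCat.epi_iff_surjective g).1 hg)
  exact hM Q (hR.isAbsolutelyWPure_of_isDivisibleModule hQ)
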